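/- Let $\phi=\frac{1+\sqrt5}{2}$. A *kite* is the quadrilateral with edges $\phi,\phi,1,1$ (the two long edges adjacent) whose symmetry axis has length $\phi$; a *dart* is the non-convex quadrilateral with edges $\phi,\phi,1,1$ (the two long edges adjacent) whose symmetry axis has length $1$. For each of them let $a$ be the vertex between the long edges, $b$ the vertex between the short edges and $c$ one of the other two vertices; the symmetry axis $ab$ cuts the tile into two halves, which are triangles $(a,b,c)$. *Deflation* cuts a half kite $(a,b,c)$ into the half kites $(c,q,b)$ and $(c,q,p)$ and the half dart $(a,p,q)$, where $q=a+(b-a)/\phi$ and $p=c+(a-c)/\phi$, and it cuts a half dart $(a,b,c)$ into the half kite $(a,b,p)$ and the half dart $(c,p,b)$, where $p=a+(c-a)/\phi$; the pieces are smaller by the factor $\phi$. Let $\tau$ be a Penrose tiling of $\mathbb R^2$ by kites and darts with edges of lengths $1$ and $\phi$, that is, a tiling each of whose finite patches occurs in the patch obtained, for some $n\ge 0$, by $n$ deflations from a half kite or half dart with edges enlarged by the factor $\phi^n$. Let $Y$ be a separated net created by $\tau$: $Y$ consists of one point chosen from each tile of $\tau$, different tiles having different points, and there are $c_1,c_2>0$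 such that distinct points of $Y$ are at distance at least $c_1$ and each point of $\mathbb R^2$ is within distance $c_2$ of $Y$. For $\rho>0$ and a square $\mathcal U$, with area $|\mathcal U|$, put $$e_\rho(\mathcal U)=\max\left\{\frac{\rho|\mathcal U|}{\#(\mathcal U\cap Y)},\ \frac{\#(\mathcal U\cap Y)}{\rho|\mathcal U|}\right\}\in[1,\infty]$$ (with value $\infty$ if $\mathcal U\cap Y=\emptyset$), and let $E_\rho(2^i)$ be the supremum of $e_\rho(\mathcal U)$ over the squares $\mathcal U=[j_1,j_1+2^i]\times[j_2,j_2+2^i]$ with $j_1,j_2\in\mathbb N$. Let $\psi$ be the area of a dart and let $\rho=\dfrac{\phi^2}{(1+\phi^2)\psi}$. Then for every integer $i\ge 50$, $$E_\rho(2^i)-1\le 10\,\phi^{-i/3}.$$ -/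

import Mathlib

open scoped goldenRatio

namespace KiteDart

/-- The two prototiles. -/
inductive Kind where
  | kite
  | dart

/-- Half of a kite or of a dart, cut along the symmetry axis, given by its labelled vertices in the
Euclidean plane `ℂ`. The axis is `ab`; `a` is the vertex at which the two long edges of the whole
tile meet, `b` is the vertex at which its two short edges meet, and `c` is the vertex off the axis.
So `ac` is a long edge and `bc` is a short edge. -/
structure HalfTile where
  kind : Kind
  a : ℂ
  b : ℂ
  c : ℂ

/-- `t` really is a half kite (half dart) with short edge `r` and long edge `φ * r`. The axis of the
kite has length `φ * r` (angles 36°, 72°, 72° at `a`, `b`, `c`), the axis of the dart has length `r`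
(angles 36°, 108°, 36° at `a`, `b`, `c`). Both orientations are allowed. -/
def HalfTile.HasScale (t : HalfTile) (r : ℝ) : Prop :=
  match t.kind with
  | .kite => dist t.a t.b = φ * r ∧ dist t.a t.c = φ * r ∧ dist t.b t.c = r
  | .dart => dist t.a t.b = r ∧ dist t.a t.c = φ * r ∧ dist t.b t.c = r

/-- The closed triangle occupied by a half tile. -/
def HalfTile.region (t : HalfTile) : Set ℂ := convexHull ℝ {t.a, t.b, t.c}

/-- Deflation: a half kite is cut into two half kites and one half dart, and a half dart is cut
into one half kite and one half dart, all of them smaller by the factor `φ`.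
In a half kite `q` divides the axis `ab` and `p` divides the long edge `ca` in the golden ratio; the
two small half kites form a whole kite with axis `cq`, and the small half dart has axis `ap`.
In a half dart `p` divides the long edge `ac` in the golden ratio. -/
noncomputable def HalfTile.deflate : HalfTile → Set HalfTile
  | ⟨.kite, a, b, c⟩ =>
      let q : ℂ := a + (b - a) / (φ : ℂ)
      let p : ℂ := c + (a - c) / (φ : ℂ)
      {⟨.kite, c, q, b⟩, ⟨.kite, c, q, p⟩, ⟨.dart, a, p, q⟩}
  | ⟨.dart, a, b, c⟩ =>
      let p : ℂ := a + (c - a) / (φ : ℂ)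
      {⟨.kite, a, b, p⟩, ⟨.dart, c, p, b⟩}

/-- The patch of half tiles obtained from one half tile by `n` deflations. -/
noncomputable def HalfTile.deflateIter (t : HalfTile) : ℕ → Set HalfTile
  | 0 => {t}
  | n + 1 => ⋃ s ∈ t.deflateIter n, s.deflate

/-- The length of the symmetry axis of a tile with edges of lengths `1` and `φ`. -/
noncomputable def Kind.axisLength : Kind → ℝ
  | .kite => φ
  | .dart => 1

/-- A kite or dart in the plane with edges of lengths `1` and `φ`, given by its kind and its
symmetry axis: `a` is the vertex between the long edges and `b` the vertex between the short edges.
Thus each kite and each dart of the plane is represented exactly once. -/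
structure Tile where
  kind : Kind
  a : ℂ
  b : ℂ
  dist_eq : dist a b = kind.axisLength

/-- The two halves of a tile; the long edges (of length `φ`) make angles `±π/5` with the axis. -/
noncomputable def Tile.half (T : Tile) (s : Bool) : HalfTile :=
  let ε : ℝ := if s then 1 else -1
  let u : ℂ := (T.b - T.a) / (T.kind.axisLength : ℂ)
  ⟨T.kind, T.a, T.b, T.a + φ * u * Complex.exp (ε * (Real.pi / 5) * Complex.I)⟩

/-- The closed region occupied by a tile. -/
def Tile.region (T : Tile) : Set ℂ := (T.half true).region ∪ (T.half false).region

/-- Penrose tilings of the plane by kites and darts with edges of lengths `1` and `φ`, as the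
substitution tilings for deflation: the tiles cover the plane without overlapping, and each finite
patch of tiles occurs in a patch that is obtained by some number `n` of deflations from a half kite
or half dart (with short edge `φ ^ n`, so that the pieces have edges `1` and `φ`). -/
structure IsPenroseTiling (τ : Set Tile) : Prop where
  covers : ⋃ T ∈ τ, T.region = Set.univ
  disjoint : τ.Pairwise fun T T' => Disjoint (interior T.region) (interior T'.region)
  patches : ∀ P : Set Tile, P ⊆ τ → P.Finite →
    ∃ (n : ℕ) (t : HalfTile), t.HasScale (φ ^ n) ∧
      ∀ T ∈ P, ∀ s : Bool, T.half s ∈ t.deflateIter n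

/-- Separated nets in the plane. -/
def IsSeparatedNet (Y : Set ℂ) : Prop :=
  ∃ c₁ > (0 : ℝ), ∃ c₂ > (0 : ℝ),
    (∀ x ∈ Y, ∀ y ∈ Y, x ≠ y → c₁ ≤ dist x y) ∧ ∀ x : ℂ, ∃ y ∈ Y, dist x y ≤ c₂

/-- `Y` is a separated net created by `τ`: it consists of one point from each tile of `τ`, the
points of different tiles being different. -/
def IsCreatedBy (Y : Set ℂ) (τ : Set Tile) : Prop :=
  IsSeparatedNet Y ∧
    ∃ y : Tile → ℂ, (∀ T ∈ τ, y T ∈ T.region) ∧ Set.InjOn y τ ∧ Y = y '' τ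

/-- The square `[j₁, j₁ + l] × [j₂, j₂ + l]`. -/
def square (j₁ j₂ : ℕ) (l : ℝ) : Set ℂ :=
  Set.Icc (j₁ : ℝ) (j₁ + l) ×ℂ Set.Icc (j₂ : ℝ) (j₂ + l)

/-- `e_ρ(U) = max {ρ|U| / #(U ∩ Y), #(U ∩ Y) / (ρ|U|)}`, as an element of `[0, ∞]` (so it is `∞` if
`U` has positive area and `U ∩ Y` is empty). -/
noncomputable def e (Y : Set ℂ) (ρ : ℝ) (U : Set ℂ) : ENNReal :=
  max (ENNReal.ofReal ρ * MeasureTheory.volume U / ((U ∩ Y).encard : ENNReal))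
    (((U ∩ Y).encard : ENNReal) / (ENNReal.ofReal ρ * MeasureTheory.volume U))

/-- `E_ρ(l)`, the supremum in `[0, ∞]` of `e_ρ(U)` over the squares `U` of side `l` above. It is at
least `1` (a positive ratio or its inverse is), so subtracting `1` in `[0, ∞]` truncates nothing. -/
noncomputable def E (Y : Set ℂ) (ρ : ℝ) (l : ℝ) : ENNReal :=
  ⨆ (j₁ : ℕ) (j₂ : ℕ), e Y ρ (square j₁ j₂ l)

/-- A dart with edges of lengths `1` and `φ`. -/
noncomputable def stdDart : Tile := ⟨.dart, 0, 1, by simp [Kind.axisLength]⟩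

/-- The area `ψ` of a dart. -/
noncomputable def dartArea : ℝ := MeasureTheory.volume.real stdDart.region

end KiteDart

namespace KiteDart

open MeasureTheory

/-! Call a half tile of scale `φ ^ m`, deflated `m` times, a supertile of order `m`. The deflation
matrix has eigenvalues `φ ^ 2` (belonging to the areas) and `φ⁻¹ ^ 2`. Hence the number of half
tiles in a supertile is its area times a constant density, with relative error at most the `m`-th
power of the quotient of the eigenvalues, `φ⁻¹ ^ (4 * m)` (`ncard_deflateIter`,
`abs_ncard_deflateIter_sub_le`). The same bound holds for every finite union of non-overlapping
supertiles (`IsDissection.abs_ncard_sub_le`).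

The tiles that meet a square form a finite patch, so they occur in a half tile deflated `n` times,
which is also a union of supertiles of order `m ≤ n`. Supertiles well inside the square bound the
number of marked points from below, those meeting a slightly larger square bound it from above, and
both unions differ from the square only within a collar of width `4 + φ * φ ^ m`
(`IsPenroseTiling.ncard_bounds`).

For side `2 ^ i` take `m = i / 3`. Since `2 ^ i ≥ φ ^ (3 * m)`, the collar has relative area of
order at most `φ ^ (-2 * m)`; this and the eigenvalue error are far below `φ ^ (-m)`, which is `φ ^
(-i / 3)` up to rounding.

The density `ρ` is defined through the area of a dart, so the numerical value of that area is never
needed: all tile areas are kept as multiples of `unitArea`. -/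

/-! ### Triangles: barycentric coordinates, cuts, areas. -/

theorem mem_triangle_iff {a b c x : ℂ} :
    x ∈ convexHull ℝ {a, b, c} ↔ ∃ α β γ : ℝ, 0 ≤ α ∧ 0 ≤ β ∧ 0 ≤ γ ∧ α + β + γ = 1 ∧
      α * a + β * b + γ * c = x := by
  constructor
  · intro h
    rw [convexHull_insert (by simp), convexHull_pair, convexJoin_singleton_left] at h
    simp only [Set.mem_iUnion] at h
    obtain ⟨y, ⟨s, t, hs, ht, hst, rfl⟩, ⟨u, v, hu, hv, huv, rfl⟩⟩ := h
    refine ⟨u, v * s, v * t, hu, by positivity, by positivity, ?_, ?_⟩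
    · rw [add_assoc, ← mul_add, hst, mul_one, huv]
    · simp only [Complex.real_smul]
      push_cast
      ring
  · rintro ⟨α, β, γ, hα, hβ, hγ, h, rfl⟩
    have ha : a ∈ convexHull ℝ {a, b, c} := subset_convexHull ℝ _ (by simp)
    have hb : b ∈ convexHull ℝ {a, b, c} := subset_convexHull ℝ _ (by simp)
    have hc : c ∈ convexHull ℝ {a, b, c} := subset_convexHull ℝ _ (by simp)
    have := (convex_convexHull ℝ {a, b, c}).sum_mem (t := Finset.univ) (w := ![α, β, γ])
      (z := ![a, b, c]) (by intro i _; fin_cases i <;> simpa)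
      (by simp [Fin.sum_univ_three, h]) (by intro i _; fin_cases i <;> simpa)
    simpa [Fin.sum_univ_three] using this

/-- Cutting a triangle along a segment from the vertex `b` to a point of the opposite side. -/
theorem triangle_cut (a b c : ℂ) {s : ℝ} (h0 : 0 < s) (h1 : s < 1) :
    convexHull ℝ {a, b, c} = convexHull ℝ {a, b, a + s * (c - a)} ∪
      convexHull ℝ {c, b, a + s * (c - a)} := by
  have h1' : 0 < 1 - s := by linarith
  apply Set.Subset.antisymm
  · intro x hx
    obtain ⟨α, β, γ, hα, hβ, hγ, h, rfl⟩ := mem_triangle_iff.1 hx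
    -- The sign of `α * s - γ * (1 - s)` tells on which side of the cut the point lies. The new
    -- coordinates come from solving `p = (1 - s) * a + s * c` for the vertex that is lost.
    rcases le_total (γ * (1 - s)) (α * s) with hle | hle
    · left
      refine mem_triangle_iff.2 ⟨α - γ * (1 - s) / s, β, γ / s, ?_, hβ, by positivity, ?_, ?_⟩
      · rw [sub_nonneg, div_le_iff₀ h0]; exact hle
      · field_simp; linear_combination s * h
      · have : (s : ℂ) ≠ 0 := by exact_mod_cast h0.ne'
        push_cast; field_simp; ring
    · right
      refine mem_triangle_iff.2 ⟨γ - α * s / (1 - s), β, α / (1 - s), ?_, hβ, by positivity, ?_, ?_⟩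
      · rw [sub_nonneg, div_le_iff₀ h1']; exact hle
      · field_simp; linear_combination (1 - s) * h
      · have : (1 - s : ℂ) ≠ 0 := by exact_mod_cast h1'.ne'
        push_cast; field_simp; ring
  · have hp : a + s * (c - a) ∈ convexHull ℝ {a, b, c} :=
      mem_triangle_iff.2 ⟨1 - s, 0, s, h1'.le, le_rfl, h0.le, by ring, by push_cast; ring⟩
    have ha : a ∈ convexHull ℝ {a, b, c} := subset_convexHull ℝ _ (by simp)
    have hb : b ∈ convexHull ℝ {a, b, c} := subset_convexHull ℝ _ (by simp)
    have hc : c ∈ convexHull ℝ {a, b, c} := subset_convexHull ℝ _ (by simp)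
    refine Set.union_subset ?_ ?_ <;> refine convexHull_min ?_ (convex_convexHull ℝ _) <;>
      · rintro x (rfl | rfl | rfl) <;> assumption

/-- Twice the signed area of a triangle. -/
noncomputable def cross (a b c : ℂ) : ℝ :=
  (b - a).re * (c - a).im - (b - a).im * (c - a).re

/-- The linear map of the plane that sends `1` to `u` and `I` to `v`. -/
noncomputable def basisMap (u v : ℂ) : ℂ →ₗ[ℝ] ℂ :=
  Complex.reLm.smulRight u + Complex.imLm.smulRight v

theorem basisMap_apply (u v z : ℂ) : basisMap u v z = z.re * u + z.im * v := by
  simp [basisMap]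

theorem det_basisMap (u v : ℂ) : LinearMap.det (basisMap u v) = u.re * v.im - u.im * v.re := by
  rw [← LinearMap.det_toMatrix Complex.basisOneI, Matrix.det_fin_two]
  simp [LinearMap.toMatrix_apply, basisMap_apply]
  ring

/-- The area of the triangle with vertices `0`, `1`, `I`. -/
noncomputable def unitArea : ENNReal := volume (convexHull ℝ {(0 : ℂ), 1, Complex.I})

/-- Every triangle is the image of the one with vertices `0`, `1`, `I` under an affine map whose
determinant is `cross a b c`. -/
theorem volume_triangle (a b c : ℂ) :
    volume (convexHull ℝ {a, b, c}) = ENNReal.ofReal |cross a b c| * unitArea := by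
  have : convexHull ℝ {a, b, c} =
      (fun x => a + x) '' (basisMap (b - a) (c - a) '' convexHull ℝ {(0 : ℂ), 1, Complex.I}) := by
    ext x
    simp only [Set.mem_image, exists_exists_and_eq_and]
    constructor
    · intro hx
      obtain ⟨α, β, γ, hα, hβ, hγ, h, rfl⟩ := mem_triangle_iff.1 hx
      refine ⟨α * 0 + β * 1 + γ * Complex.I,
        mem_triangle_iff.2 ⟨α, β, γ, hα, hβ, hγ, h, rfl⟩, ?_⟩
      have h' : (α : ℂ) + β + γ = 1 := by exact_mod_cast h
      simp [basisMap_apply]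
      linear_combination -a * h'
    · rintro ⟨y, hy, rfl⟩
      obtain ⟨α, β, γ, hα, hβ, hγ, h, rfl⟩ := mem_triangle_iff.1 hy
      refine mem_triangle_iff.2 ⟨α, β, γ, hα, hβ, hγ, h, ?_⟩
      have h' : (α : ℂ) + β + γ = 1 := by exact_mod_cast h
      simp [basisMap_apply]
      linear_combination a * h'
  rw [this, Set.image_add_left, measure_preimage_add, Measure.addHaar_image_linearMap,
    det_basisMap]
  rfl

theorem isCompact_triangle (a b c : ℂ) : IsCompact (convexHull ℝ {a, b, c}) :=
  Set.Finite.isCompact_convexHull (𝕜 := ℝ) (by simp)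

theorem unitArea_ne_top : unitArea ≠ ⊤ := (isCompact_triangle _ _ _).measure_ne_top

theorem unitArea_ne_zero : unitArea ≠ 0 := by
  have hsub : Metric.ball (1 / 4 + 1 / 4 * Complex.I) (1 / 8) ⊆
      convexHull ℝ {(0 : ℂ), 1, Complex.I} := by
    intro z hz
    rw [Metric.mem_ball, Complex.dist_eq] at hz
    have h1 := (Complex.abs_re_le_norm _).trans_lt hz
    have h2 := (Complex.abs_im_le_norm _).trans_lt hz
    rw [abs_lt] at h1 h2
    norm_num at h1 h2
    refine mem_triangle_iff.2 ⟨1 - z.re - z.im, z.re, z.im, by linarith, by linarith, by linarith,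
      by ring, ?_⟩
    simp [Complex.re_add_im]
  exact ne_of_gt (lt_of_lt_of_le (Metric.measure_ball_pos _ _ (by norm_num)) (measure_mono hsub))

/-- The pieces have the fractions `s` and `1 - s` of the whole area, so inclusion-exclusion leaves
measure zero for their intersection. -/
theorem aedisjoint_triangle_cut (a b c : ℂ) {s : ℝ} (h0 : 0 < s) (h1 : s < 1) :
    AEDisjoint volume (convexHull ℝ {a, b, a + s * (c - a)})
      (convexHull ℝ {c, b, a + s * (c - a)}) := by
  have key := measure_union_add_inter (μ := volume) (convexHull ℝ {a, b, a + s * (c - a)})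
    (isCompact_triangle c b (a + s * (c - a))).measurableSet
  rw [← triangle_cut a b c h0 h1, volume_triangle a b c, volume_triangle a b (_ + _),
    volume_triangle c b, ← add_mul, ← ENNReal.ofReal_add (abs_nonneg _) (abs_nonneg _)] at key
  have e1 : cross a b (a + s * (c - a)) = s * cross a b c := by
    simp [cross]; ring
  have e2 : cross c b (a + s * (c - a)) = -(1 - s) * cross a b c := by
    simp [cross]; ring
  rw [e1, e2, abs_mul, abs_mul, abs_neg, abs_of_pos h0, abs_of_pos (sub_pos.2 h1), ← add_mul,
    add_sub_cancel, one_mul] at key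
  have hfin : ENNReal.ofReal |cross a b c| * unitArea ≠ ⊤ :=
    ENNReal.mul_ne_top ENNReal.ofReal_ne_top unitArea_ne_top
  exact (ENNReal.add_right_inj hfin).1 (by rw [key, add_zero])

/-- Stewart's theorem. -/
theorem dist_sq_cevian (a b c : ℂ) (s : ℝ) :
    dist c (a + s * (b - a)) ^ 2 =
      (1 - s) * dist a c ^ 2 + s * dist b c ^ 2 - s * (1 - s) * dist a b ^ 2 := by
  simp only [Complex.dist_eq, ← Complex.normSq_eq_norm_sq, Complex.normSq_apply]
  simp
  ring

/-- Heron's formula. -/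
theorem cross_sq (a b c : ℂ) : 4 * cross a b c ^ 2 = 4 * dist a b ^ 2 * dist a c ^ 2 -
    (dist a b ^ 2 + dist a c ^ 2 - dist b c ^ 2) ^ 2 := by
  simp only [Complex.dist_eq, ← Complex.normSq_eq_norm_sq, Complex.normSq_apply, cross]
  simp
  ring

theorem dist_cevian_left (a b : ℂ) {s : ℝ} (h0 : 0 ≤ s) :
    dist a (a + s * (b - a)) = s * dist a b := by
  rw [Complex.dist_eq, Complex.dist_eq, sub_add_cancel_left, norm_neg, norm_mul, Complex.norm_real,
    Real.norm_of_nonneg h0, norm_sub_rev]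

theorem dist_cevian_right (a b : ℂ) {s : ℝ} (h1 : s ≤ 1) :
    dist (a + s * (b - a)) b = (1 - s) * dist a b := by
  rw [Complex.dist_eq, Complex.dist_eq,
    show a + s * (b - a) - b = ((1 - s : ℝ) : ℂ) * (a - b) by push_cast; ring, norm_mul,
    Complex.norm_real, Real.norm_of_nonneg (by linarith)]

/-! ### Size and area of half tiles. -/

theorem inv_goldenRatio_eq : φ⁻¹ = φ - 1 := by
  rw [Real.inv_goldenRatio, ← Real.one_sub_goldenConj, neg_sub]

theorem inv_goldenRatio_pos : 0 < φ⁻¹ := inv_pos.2 Real.goldenRatio_pos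

theorem inv_goldenRatio_lt_one : φ⁻¹ < 1 := inv_lt_one_of_one_lt₀ Real.one_lt_goldenRatio

theorem Kind.axisLength_pos (k : Kind) : 0 < k.axisLength := by
  cases k
  · exact Real.goldenRatio_pos
  · exact one_pos

theorem div_goldenRatio_eq (z : ℂ) : z / (φ : ℂ) = ((φ⁻¹ : ℝ) : ℂ) * z := by
  push_cast; rw [div_eq_inv_mul]

/-- The area of half a dart with edges of lengths `1` and `φ`. -/
noncomputable def halfDartArea : ℝ := √(φ + 2) / 2 * unitArea.toReal

theorem halfDartArea_pos : 0 < halfDartArea := by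
  have := Real.goldenRatio_pos
  have := ENNReal.toReal_pos unitArea_ne_zero unitArea_ne_top
  unfold halfDartArea
  positivity

/-- For both shapes Heron's formula reduces by `φ ^ 2 = φ + 1` to this common form; in particular
the areas are proportional to the axes, `φ : 1`. -/
theorem HalfTile.HasScale.abs_cross {t : HalfTile} {r : ℝ} (h : t.HasScale r) :
    |cross t.a t.b t.c| = t.kind.axisLength * r ^ 2 * (√(φ + 2) / 2) := by
  have hφ := Real.goldenRatio_pos
  have h2 := Real.goldenRatio_sq
  have hs : √(φ + 2) ^ 2 = φ + 2 := Real.sq_sqrt (by positivity)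
  have hk := t.kind.axisLength_pos
  have key := cross_sq t.a t.b t.c
  rw [← abs_of_nonneg (show 0 ≤ t.kind.axisLength * r ^ 2 * (√(φ + 2) / 2) by positivity),
    ← sq_eq_sq_iff_abs_eq_abs, mul_pow _ (√(φ + 2) / 2), div_pow, hs]
  obtain ⟨k, a, b, c⟩ := t
  cases k <;> obtain ⟨h₁, h₂, h₃⟩ := h <;> simp only at h₁ h₂ h₃ key <;>
    rw [h₁, h₂, h₃] at key <;> simp only [Kind.axisLength] <;> clear hs hk <;>
    generalize φ = g at * <;> grind

theorem HalfTile.HasScale.volume_region {t : HalfTile} {r : ℝ} (h : t.HasScale r) :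
    volume t.region = ENNReal.ofReal (t.kind.axisLength * r ^ 2 * halfDartArea) := by
  have hk := t.kind.axisLength_pos
  have := Real.goldenRatio_pos
  rw [HalfTile.region, volume_triangle, h.abs_cross, halfDartArea, ← mul_assoc,
    ENNReal.ofReal_mul (p := _ * (√(φ + 2) / 2)) (by positivity),
    ENNReal.ofReal_toReal unitArea_ne_top]

theorem HalfTile.HasScale.volume_region_pos {t : HalfTile} {r : ℝ} (h : t.HasScale r)
    (hr : 0 < r) : 0 < volume t.region := by
  have hk := t.kind.axisLength_pos
  have := halfDartArea_pos
  rw [h.volume_region, ENNReal.ofReal_pos]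
  positivity

theorem HalfTile.isCompact_region (t : HalfTile) : IsCompact t.region := isCompact_triangle _ _ _

theorem HalfTile.HasScale.dist_le {t : HalfTile} {r : ℝ} (h : t.HasScale r) (hr : 0 < r)
    {x y : ℂ} (hx : x ∈ t.region) (hy : y ∈ t.region) : dist x y ≤ φ * r := by
  have h1 := Real.one_lt_goldenRatio
  have hφ := Real.goldenRatio_pos
  have hr' : r ≤ φ * r := by nlinarith
  refine (Metric.dist_le_diam_of_mem t.isCompact_region.isBounded hx hy).trans ?_
  rw [HalfTile.region, convexHull_diam]
  have hd : dist t.a t.b ≤ φ * r ∧ dist t.a t.c ≤ φ * r ∧ dist t.b t.c ≤ φ * r := by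
    obtain ⟨k, a, b, c⟩ := t
    cases k <;> obtain ⟨h₁, h₂, h₃⟩ := h <;> simp only at h₁ h₂ h₃ ⊢ <;> rw [h₁, h₂, h₃] <;>
      exact ⟨by linarith, by linarith, by linarith⟩
  obtain ⟨h₁, h₂, h₃⟩ := hd
  refine Metric.diam_le_of_forall_dist_le (by positivity) ?_
  rintro x (rfl | rfl | rfl) y (rfl | rfl | rfl) <;>
    first
      | (rw [dist_self]; positivity)
      | assumption
      | (rw [dist_comm]; assumption)

/-! ### Dissections and deflation. -/

/-- `S` is a finite set of half tiles of scale `r` that cover `A` and do not overlap. -/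
structure IsDissection (S : Set HalfTile) (A : Set ℂ) (r : ℝ) : Prop where
  finite : S.Finite
  hasScale : ∀ t ∈ S, t.HasScale r
  iUnion : ⋃ t ∈ S, t.region = A
  aedisjoint : S.Pairwise fun s t => AEDisjoint volume s.region t.region

theorem IsDissection.subset {S : Set HalfTile} {A : Set ℂ} {r : ℝ} (h : IsDissection S A r)
    {t : HalfTile} (ht : t ∈ S) : t.region ⊆ A := by
  rw [← h.iUnion]
  exact Set.subset_biUnion_of_mem (u := HalfTile.region) ht

theorem IsDissection.exists_mem {S : Set HalfTile} {A : Set ℂ} {r : ℝ} (h : IsDissection S A r)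
    {x : ℂ} (hx : x ∈ A) : ∃ t ∈ S, x ∈ t.region := by
  rw [← h.iUnion] at hx
  simpa using hx

theorem IsDissection.singleton {t : HalfTile} {r : ℝ} (h : t.HasScale r) :
    IsDissection {t} t.region r where
  finite := Set.finite_singleton t
  hasScale := by simpa using h
  iUnion := by simp
  aedisjoint := Set.pairwise_singleton _ _

theorem IsDissection.trans {S : Set HalfTile} {A : Set ℂ} {r r' : ℝ} (h : IsDissection S A r)
    {f : HalfTile → Set HalfTile} (hf : ∀ t ∈ S, IsDissection (f t) t.region r') :
    IsDissection (⋃ t ∈ S, f t) A r' where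
  finite := h.finite.biUnion fun t ht => (hf t ht).finite
  hasScale u hu := by
    obtain ⟨t, ht, hu⟩ := Set.mem_iUnion₂.1 hu
    exact (hf t ht).hasScale u hu
  iUnion := by
    rw [← h.iUnion]
    simp only [Set.biUnion_iUnion]
    exact Set.iUnion₂_congr fun t ht => (hf t ht).iUnion
  aedisjoint u hu v hv huv := by
    obtain ⟨s, hs, hu⟩ := Set.mem_iUnion₂.1 hu
    obtain ⟨t, ht, hv⟩ := Set.mem_iUnion₂.1 hv
    by_cases hst : s = t
    · subst hst
      exact (hf s hs).aedisjoint hu hv huv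
    · exact (h.aedisjoint hs ht hst).mono ((hf s hs).subset hu) ((hf t ht).subset hv)

theorem sq_cancel {x y : ℝ} (hx : 0 ≤ x) (hy : 0 ≤ y) (h : x ^ 2 = y ^ 2) : x = y :=
  (sq_eq_sq₀ hx hy).1 h

/-- Two cuts: from `c` to `q` on the axis, then from `q` to `p` on the long edge. Stewart's theorem
gives `cq = r` and `qp = r / φ`; the other new lengths are golden sections of edges. -/
theorem isDissection_deflate_kite {a b c : ℂ} {r : ℝ} (hr : 0 < r)
    (h : (⟨.kite, a, b, c⟩ : HalfTile).HasScale r) :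
    IsDissection (⟨.kite, a, b, c⟩ : HalfTile).deflate (⟨.kite, a, b, c⟩ : HalfTile).region
      (r / φ) := by
  have hφ := Real.goldenRatio_pos
  have hs0 := inv_goldenRatio_pos
  have hs1 := inv_goldenRatio_lt_one
  have h2 := Real.goldenRatio_sq
  have hφs : φ * φ⁻¹ = 1 := mul_inv_cancel₀ hφ.ne'
  have hse := inv_goldenRatio_eq
  simp only [HalfTile.deflate, HalfTile.region, div_goldenRatio_eq]
  obtain ⟨hab, hac, hbc⟩ := h
  simp only at hab hac hbc
  generalize hs : φ⁻¹ = s at *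
  generalize hg : φ = g at *
  have hq₁ := dist_cevian_left a b hs0.le
  have hq₂ := dist_cevian_right a b hs1.le
  have hq₃ := dist_sq_cevian a b c s
  have hp₁ := dist_cevian_left c a hs0.le
  have hp₂ := dist_cevian_right c a hs1.le
  have hp₃ := dist_sq_cevian c a (a + s * (b - a)) s
  have cut₁ := triangle_cut a c b hs0 hs1
  have dis₁ := aedisjoint_triangle_cut a c b hs0 hs1
  have cut₂ := triangle_cut c (a + s * (b - a)) a hs0 hs1
  have dis₂ := aedisjoint_triangle_cut c (a + s * (b - a)) a hs0 hs1
  generalize a + s * (b - a) = q at *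
  generalize c + s * (a - c) = p at *
  have hcq : dist c q = r := by
    refine sq_cancel dist_nonneg hr.le ?_
    rw [hq₃, hac, hbc, hab, hse]
    grind
  have hqp : dist q p = r / g := by
    refine sq_cancel dist_nonneg (by positivity) ?_
    rw [hp₃, hq₁, hcq, dist_comm c a, hab, hac, div_eq_mul_inv, hs, hse]
    grind
  have hrs : g * (r / g) = r := by field_simp
  have hrs' : r / g = s * r := by rw [← hs]; ring
  have perm₁ : ({a, c, q} : Set ℂ) = {c, q, a} := by
    rw [Set.insert_comm, Set.pair_comm]
  have perm₂ : ({b, c, q} : Set ℂ) = {c, q, b} := by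
    rw [Set.insert_comm, Set.pair_comm b]
  have perm₃ : ({a, q, p} : Set ℂ) = {a, p, q} := by rw [Set.pair_comm]
  rw [perm₁, perm₂] at cut₁ dis₁
  rw [perm₃] at cut₂ dis₂
  rw [Set.pair_comm b c, cut₁]
  rw [cut₂] at cut₁ dis₁ ⊢
  have dis₃ := dis₁.mono Set.subset_union_left Set.Subset.rfl
  have dis₄ := dis₁.mono Set.subset_union_right Set.Subset.rfl
  refine ⟨by simp, ?_, ?_, ?_⟩
  · rintro t (rfl | rfl | rfl) <;> simp only [HalfTile.HasScale, hg]
    · refine ⟨by rw [hcq, hrs], by rw [dist_comm, hbc, hrs], ?_⟩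
      rw [hq₂, hab, hrs', hse]; linear_combination -r * h2
    · refine ⟨by rw [hcq, hrs], ?_, hqp⟩
      rw [hp₁, dist_comm, hac, hrs, ← mul_assoc, mul_comm s, hφs, one_mul]
    · refine ⟨?_, ?_, by rw [dist_comm, hqp]⟩
      · rw [dist_comm, hp₂, dist_comm, hac, hrs', hse]; linear_combination -r * h2
      · rw [hq₁, hab, hrs, ← mul_assoc, mul_comm s, hφs, one_mul]
  · simp only [Set.biUnion_insert, Set.biUnion_singleton]
    rw [Set.union_comm]
    rfl
  · rintro t (rfl | rfl | rfl) u (rfl | rfl | rfl) htu <;>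
      first
        | exact absurd rfl htu
        | assumption
        | exact AEDisjoint.symm (by assumption)

/-- One cut from `b` to `p` on the long edge; Stewart's theorem gives `bp = r / φ`. -/
theorem isDissection_deflate_dart {a b c : ℂ} {r : ℝ} (hr : 0 < r)
    (h : (⟨.dart, a, b, c⟩ : HalfTile).HasScale r) :
    IsDissection (⟨.dart, a, b, c⟩ : HalfTile).deflate (⟨.dart, a, b, c⟩ : HalfTile).region
      (r / φ) := by
  have hφ := Real.goldenRatio_pos
  have hs0 := inv_goldenRatio_pos
  have hs1 := inv_goldenRatio_lt_one
  have h2 := Real.goldenRatio_sq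
  have hφs : φ * φ⁻¹ = 1 := mul_inv_cancel₀ hφ.ne'
  have hse := inv_goldenRatio_eq
  simp only [HalfTile.deflate, HalfTile.region, div_goldenRatio_eq]
  obtain ⟨hab, hac, hbc⟩ := h
  simp only at hab hac hbc
  generalize hs : φ⁻¹ = s at *
  generalize hg : φ = g at *
  have hp₁ := dist_cevian_left a c hs0.le
  have hp₂ := dist_cevian_right a c hs1.le
  have hp₃ := dist_sq_cevian a c b s
  have cut := triangle_cut a b c hs0 hs1
  have dis := aedisjoint_triangle_cut a b c hs0 hs1
  generalize a + s * (c - a) = p at *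
  have hbp : dist b p = r / g := by
    refine sq_cancel dist_nonneg (by positivity) ?_
    rw [hp₃, dist_comm c b, hab, hbc, hac, div_eq_mul_inv, hs, hse]
    grind
  have hrs : g * (r / g) = r := by field_simp
  have hrs' : r / g = s * r := by rw [← hs]; ring
  have perm : ({c, b, p} : Set ℂ) = {c, p, b} := by rw [Set.pair_comm]
  rw [perm] at cut dis
  rw [cut]
  refine ⟨by simp, ?_, ?_, ?_⟩
  · rintro t (rfl | rfl) <;> simp only [HalfTile.HasScale, hg]
    · refine ⟨by rw [hab, hrs], ?_, hbp⟩
      rw [hp₁, hac, hrs, ← mul_assoc, mul_comm s, hφs, one_mul]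
    · refine ⟨?_, by rw [dist_comm, hbc, hrs], by rw [dist_comm, hbp]⟩
      rw [dist_comm, hp₂, hac, hrs', hse]; linear_combination -r * h2
  · simp only [Set.biUnion_insert, Set.biUnion_singleton]
    rfl
  · rintro t (rfl | rfl) u (rfl | rfl) htu <;>
      first
        | exact absurd rfl htu
        | assumption
        | exact AEDisjoint.symm (by assumption)

theorem isDissection_deflate {t : HalfTile} {r : ℝ} (hr : 0 < r) (h : t.HasScale r) :
    IsDissection t.deflate t.region (r / φ) := by
  obtain ⟨k, a, b, c⟩ := t
  cases k
  · exact isDissection_deflate_kite hr h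
  · exact isDissection_deflate_dart hr h

theorem isDissection_deflateIter {t : HalfTile} {r : ℝ} (hr : 0 < r) (h : t.HasScale r) (n : ℕ) :
    IsDissection (t.deflateIter n) t.region (r / φ ^ n) := by
  have hφ := Real.goldenRatio_pos
  induction n with
  | zero => simpa [HalfTile.deflateIter] using IsDissection.singleton h
  | succ n ih =>
    rw [pow_succ, ← div_div]
    exact ih.trans fun s hs => isDissection_deflate (by positivity) (ih.hasScale s hs)

theorem HalfTile.deflateIter_add (t : HalfTile) (n m : ℕ) :
    t.deflateIter (n + m) = ⋃ s ∈ t.deflateIter n, s.deflateIter m := by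
  induction m with
  | zero => simp [HalfTile.deflateIter]
  | succ m ih =>
    rw [← add_assoc]
    simp only [HalfTile.deflateIter, ih, Set.biUnion_iUnion]

/-- A common half tile would lie in the null set `A ∩ B`, but its area is positive. Thus non-overlap
of regions makes cardinalities additive. -/
theorem disjoint_of_aedisjoint {S T : Set HalfTile} {A B : Set ℂ} {r r' : ℝ} (hr : 0 < r)
    (hS : IsDissection S A r) (hT : IsDissection T B r') (h : AEDisjoint volume A B) :
    Disjoint S T := by
  refine Set.disjoint_left.2 fun t hs ht => ?_
  have h0 : volume (t.region ∩ t.region) = 0 := h.mono (hS.subset hs) (hT.subset ht)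
  rw [Set.inter_self] at h0
  exact ((hS.hasScale t hs).volume_region_pos hr).ne' h0

theorem ncard_biUnion_finset {ι α : Type*} (F : Finset ι) (f : ι → Set α)
    (hf : ∀ i ∈ F, (f i).Finite) (hd : (F : Set ι).PairwiseDisjoint f) :
    (⋃ i ∈ F, f i).ncard = ∑ i ∈ F, (f i).ncard := by
  classical
  induction F using Finset.induction_on with
  | empty => simp
  | insert a F ha ih =>
    have hdis : Disjoint (f a) (⋃ i ∈ F, f i) := by
      rw [Set.disjoint_iUnion₂_right]
      refine fun i hi => hd (by simp) (by simp [hi]) ?_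
      rintro rfl
      exact ha hi
    rw [Finset.set_biUnion_insert, Finset.sum_insert ha,
      Set.ncard_union_eq hdis (hf a (Finset.mem_insert_self a F))
        (F.finite_toSet.biUnion fun i hi => hf i (Finset.mem_insert_of_mem hi)),
      ih (fun i hi => hf i (Finset.mem_insert_of_mem hi)) (hd.subset (by simp))]

theorem IsDissection.mono {S S' : Set HalfTile} {A : Set ℂ} {r : ℝ} (h : IsDissection S A r)
    (hS : S' ⊆ S) : IsDissection S' (⋃ t ∈ S', t.region) r where
  finite := h.finite.subset hS
  hasScale t ht := h.hasScale t (hS ht)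
  iUnion := rfl
  aedisjoint := h.aedisjoint.mono hS

/-! ### Counting half tiles in supertiles. -/

/-- The eigenvalue `φ⁻²` of the deflation matrix belongs to this weight. -/
noncomputable def Kind.weight : Kind → ℝ
  | .kite => -φ⁻¹
  | .dart => 1

theorem HalfTile.deflateIter_succ' (t : HalfTile) (m : ℕ) :
    t.deflateIter (m + 1) = ⋃ s ∈ t.deflate, s.deflateIter m := by
  rw [add_comm, HalfTile.deflateIter_add]
  simp [HalfTile.deflateIter]

/-- The vector `(1, 1)` of counts, times `1 + φ ^ 2`, is `φ ^ 2` times the vector of axis lengths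
plus the vector of weights. These are eigenvectors of deflation for `φ ^ 2` and `φ⁻¹ ^ 2`. -/
theorem ncard_deflateIter {t : HalfTile} {r : ℝ} (hr : 0 < r) (h : t.HasScale r) (m : ℕ) :
    (1 + φ ^ 2) * ((t.deflateIter m).ncard : ℝ) =
      φ ^ 2 * φ ^ (2 * m) * t.kind.axisLength + φ⁻¹ ^ (2 * m) * t.kind.weight := by
  have hφ := Real.goldenRatio_pos
  have h2 := Real.goldenRatio_sq
  have hse := inv_goldenRatio_eq
  induction m generalizing t r with
  | zero =>
    simp only [HalfTile.deflateIter, Set.ncard_singleton, mul_zero, pow_zero]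
    cases t.kind <;> simp only [Kind.axisLength, Kind.weight, hse] <;>
      generalize φ = g at * <;> push_cast <;> grind
  | succ m ih =>
    have hr' : 0 < r / φ := by positivity
    have hd := isDissection_deflate hr h
    have hdisj : ∀ u ∈ t.deflate, ∀ v ∈ t.deflate, u ≠ v →
        Disjoint (u.deflateIter m) (v.deflateIter m) := fun u hu v hv huv =>
      disjoint_of_aedisjoint (by positivity) (isDissection_deflateIter hr' (hd.hasScale u hu) m)
        (isDissection_deflateIter hr' (hd.hasScale v hv) m) (hd.aedisjoint hu hv huv)
    have hfin : ∀ u ∈ t.deflate, (u.deflateIter m).Finite := fun u hu =>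
      (isDissection_deflateIter hr' (hd.hasScale u hu) m).finite
    have hcount := fun u hu => ih hr' (hd.hasScale u hu)
    rw [HalfTile.deflateIter_succ']
    obtain ⟨k, a, b, c⟩ := t
    cases k
    -- The two small half kites differ only in their last vertices `b` and `p`, and a set would
    -- merge them if these agreed. They do not: `ab = φ * r`, whereas `ap = r / φ`.
    · have hbp : b ≠ c + (a - c) / (φ : ℂ) := by
        intro hb
        have hap := (hd.hasScale ⟨.dart, a, _, _⟩ (Or.inr (Or.inr rfl))).1
        have hab := h.1
        simp only at hap hab
        rw [← hb, hab, eq_div_iff hφ.ne'] at hap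
        have := Real.one_lt_goldenRatio
        generalize φ = g at *
        have h3 : r * (g * g - 1) = 0 := by linear_combination hap
        rcases mul_eq_zero.1 h3 with h3 | h3 <;> nlinarith
      simp only [HalfTile.deflate] at hdisj hfin hcount ⊢
      generalize a + (b - a) / (φ : ℂ) = q at *
      generalize c + (a - c) / (φ : ℂ) = p at *
      have d₁ := hdisj ⟨.kite, c, q, b⟩ (by simp) ⟨.kite, c, q, p⟩ (by simp) (by simpa using hbp)
      have d₂ := hdisj ⟨.kite, c, q, b⟩ (by simp) ⟨.dart, a, p, q⟩ (by simp) (by simp)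
      have d₃ := hdisj ⟨.kite, c, q, p⟩ (by simp) ⟨.dart, a, p, q⟩ (by simp) (by simp)
      have f₁ := hfin ⟨.kite, c, q, b⟩ (by simp)
      have f₂ := hfin ⟨.kite, c, q, p⟩ (by simp)
      have f₃ := hfin ⟨.dart, a, p, q⟩ (by simp)
      have c₁ := hcount ⟨.kite, c, q, b⟩ (by simp)
      have c₂ := hcount ⟨.kite, c, q, p⟩ (by simp)
      have c₃ := hcount ⟨.dart, a, p, q⟩ (by simp)
      rw [Set.biUnion_insert, Set.biUnion_insert, Set.biUnion_singleton,
        Set.ncard_union_eq (Set.disjoint_union_right.2 ⟨d₁, d₂⟩) f₁ (f₂.union f₃),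
        Set.ncard_union_eq d₃ f₂ f₃]
      push_cast
      rw [mul_add, mul_add, c₁, c₂, c₃, mul_add, pow_add, pow_add]
      simp only [Kind.axisLength, Kind.weight]
      generalize φ ^ (2 * m) = x
      generalize φ⁻¹ ^ (2 * m) = z
      rw [hse]
      clear * - h2
      generalize φ = g at *
      grind
    · simp only [HalfTile.deflate] at hdisj hfin hcount ⊢
      generalize a + (c - a) / (φ : ℂ) = p at *
      have d₁ := hdisj ⟨.kite, a, b, p⟩ (by simp) ⟨.dart, c, p, b⟩ (by simp) (by simp)
      have f₁ := hfin ⟨.kite, a, b, p⟩ (by simp)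
      have f₂ := hfin ⟨.dart, c, p, b⟩ (by simp)
      have c₁ := hcount ⟨.kite, a, b, p⟩ (by simp)
      have c₂ := hcount ⟨.dart, c, p, b⟩ (by simp)
      rw [Set.biUnion_insert, Set.biUnion_singleton, Set.ncard_union_eq d₁ f₁ f₂]
      push_cast
      rw [mul_add, c₁, c₂, mul_add, pow_add, pow_add]
      simp only [Kind.axisLength, Kind.weight]
      generalize φ ^ (2 * m) = x
      generalize φ⁻¹ ^ (2 * m) = z
      rw [hse]
      clear * - h2
      generalize φ = g at *
      grind

/-- The number of half tiles per unit of area in a Penrose tiling. -/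
noncomputable def halfTileDensity : ℝ := φ ^ 2 / ((1 + φ ^ 2) * halfDartArea)

theorem halfTileDensity_pos : 0 < halfTileDensity := by
  have := halfDartArea_pos
  have := Real.goldenRatio_pos
  unfold halfTileDensity
  positivity

theorem Kind.abs_weight_le (k : Kind) : |k.weight| ≤ φ ^ 2 * k.axisLength := by
  have h0 := inv_goldenRatio_pos
  have h1 := inv_goldenRatio_lt_one
  have h2 := Real.one_lt_goldenRatio
  cases k <;> simp only [Kind.weight, Kind.axisLength]
  · rw [abs_neg, abs_of_pos h0]
    nlinarith
  · rw [abs_one]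
    nlinarith

/-- The `φ ^ 2` part of the exact count is density times area. The rest is `φ⁻¹ ^ (2 * m)` against a
main term of order `φ ^ (2 * m)`, hence the exponent `4 * m`. A relative error has the merit of
adding up over supertiles. -/
theorem abs_ncard_deflateIter_sub_le {t : HalfTile} {m : ℕ} (h : t.HasScale (φ ^ m)) :
    |((t.deflateIter m).ncard : ℝ) - halfTileDensity * volume.real t.region| ≤
      φ⁻¹ ^ (4 * m) * (halfTileDensity * volume.real t.region) := by
  have hφ := Real.goldenRatio_pos
  have hk := t.kind.axisLength_pos
  have hα := halfDartArea_pos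
  have key := ncard_deflateIter (by positivity) h m
  have hv : halfTileDensity * volume.real t.region =
      φ ^ 2 * φ ^ (2 * m) * t.kind.axisLength / (1 + φ ^ 2) := by
    rw [Measure.real, h.volume_region, ENNReal.toReal_ofReal (by positivity), halfTileDensity]
    field_simp
    ring
  have hsub : ((t.deflateIter m).ncard : ℝ) - halfTileDensity * volume.real t.region =
      φ⁻¹ ^ (2 * m) * t.kind.weight / (1 + φ ^ 2) := by
    rw [hv, sub_eq_iff_eq_add, ← add_div, eq_div_iff (by positivity), mul_comm, key, add_comm]
  have hx : φ⁻¹ ^ (2 * m) * φ ^ (2 * m) = 1 := by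
    rw [← mul_pow, inv_mul_cancel₀ hφ.ne', one_pow]
  rw [hsub, hv, abs_div, abs_mul, abs_of_pos (by positivity : 0 < φ⁻¹ ^ (2 * m)),
    abs_of_pos (by positivity : 0 < 1 + φ ^ 2), ← mul_div_assoc]
  refine div_le_div_of_nonneg_right ?_ (by positivity)
  calc φ⁻¹ ^ (2 * m) * |t.kind.weight| ≤ φ⁻¹ ^ (2 * m) * (φ ^ 2 * t.kind.axisLength) := by
        gcongr
        exact t.kind.abs_weight_le
    _ = φ⁻¹ ^ (2 * m) * (φ⁻¹ ^ (2 * m) * φ ^ (2 * m)) * (φ ^ 2 * t.kind.axisLength) := by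
        rw [hx, mul_one]
    _ = φ⁻¹ ^ (4 * m) * (φ ^ 2 * φ ^ (2 * m) * t.kind.axisLength) := by
        rw [show 4 * m = 2 * m + 2 * m by ring, pow_add]; ring

theorem IsDissection.abs_ncard_sub_le {S : Set HalfTile} {A : Set ℂ} {m : ℕ}
    (h : IsDissection S A (φ ^ m)) :
    |((⋃ t ∈ S, t.deflateIter m).ncard : ℝ) - halfTileDensity * volume.real A| ≤
      φ⁻¹ ^ (4 * m) * (halfTileDensity * volume.real A) := by
  have hφ := Real.goldenRatio_pos
  have hr : 0 < φ ^ m := by positivity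
  obtain ⟨F, rfl⟩ := h.finite.exists_finset_coe
  have hiter := fun t ht => isDissection_deflateIter hr (h.hasScale t ht) m
  have hN : (⋃ t ∈ F, t.deflateIter m).ncard = ∑ t ∈ F, (t.deflateIter m).ncard := by
    refine ncard_biUnion_finset F _ (fun t ht => (hiter t ht).finite) fun s hs t ht hst => ?_
    exact disjoint_of_aedisjoint (by positivity) (hiter s hs) (hiter t ht) (h.aedisjoint hs ht hst)
  have hA : volume.real A = ∑ t ∈ F, volume.real t.region := by
    rw [← h.iUnion]
    exact measureReal_biUnion_finset₀ h.aedisjoint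
      (fun t _ => t.isCompact_region.measurableSet.nullMeasurableSet)
      (fun t _ => t.isCompact_region.measure_ne_top)
  simp only [Finset.mem_coe]
  rw [hN, hA, Finset.mul_sum, Finset.mul_sum]
  push_cast
  rw [← Finset.sum_sub_distrib]
  exact (Finset.abs_sum_le_sum_abs _ _).trans
    (Finset.sum_le_sum fun t ht => abs_ncard_deflateIter_sub_le (h.hasScale t ht))

/-! ### The area of a dart. -/

theorem cos_pi_div_five_eq : Real.cos (Real.pi / 5) = φ / 2 := by
  rw [Real.cos_pi_div_five, Real.goldenRatio]; ring

/-- By `cos (π / 5) = φ / 2` the short edges of `stdDart` have length `1`. Its halves lie on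
different sides of the real axis, so they overlap in a null set. -/
theorem dartArea_eq : dartArea = 2 * halfDartArea := by
  have hφ := Real.goldenRatio_pos
  have hsc : ∀ s, (stdDart.half s).HasScale 1 := by
    intro s
    have hcos := cos_pi_div_five_eq
    have hsin := Real.sin_sq_add_cos_sq (Real.pi / 5)
    have h2 := Real.goldenRatio_sq
    have hnorm : ∀ ε : ℝ, ‖Complex.exp (ε * (Real.pi / 5) * Complex.I)‖ = 1 := fun ε => by
      have := Complex.norm_exp_ofReal_mul_I (ε * (Real.pi / 5))
      push_cast at this
      exact this
    have hre : ∀ ε : ℝ, (ε = 1 ∨ ε = -1) →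
        ‖1 - (φ : ℂ) * Complex.exp (ε * (Real.pi / 5) * Complex.I)‖ = 1 := fun ε hε => by
      have e1 : Complex.exp (ε * (Real.pi / 5) * Complex.I) =
          Real.cos (Real.pi / 5) + ε * Real.sin (Real.pi / 5) * Complex.I := by
        rcases hε with rfl | rfl
        · push_cast
          rw [one_mul, one_mul, Complex.exp_mul_I]
        · push_cast
          rw [neg_one_mul, Complex.exp_mul_I, Complex.cos_neg, Complex.sin_neg]
          ring
      refine sq_cancel (norm_nonneg _) zero_le_one ?_
      rw [e1, ← Complex.normSq_eq_norm_sq, Complex.normSq_apply]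
      simp only [Complex.sub_re, Complex.sub_im, Complex.mul_re, Complex.mul_im, Complex.add_re,
        Complex.add_im, Complex.ofReal_re, Complex.ofReal_im, Complex.I_re, Complex.I_im,
        Complex.one_re, Complex.one_im]
      rw [hcos] at hsin ⊢
      have hε2 : ε ^ 2 = 1 := by rcases hε with rfl | rfl <;> norm_num
      generalize Real.sin (Real.pi / 5) = x at *
      generalize φ = g at *
      grind
    simp only [HalfTile.HasScale, Tile.half, stdDart, Kind.axisLength]
    refine ⟨by simp, ?_, ?_⟩
    · rw [zero_add, dist_zero_left, norm_mul, norm_mul, hnorm, Complex.norm_real,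
        Real.norm_of_nonneg hφ.le]
      simp
    · have := hre (if s then 1 else -1) (by cases s <;> simp)
      rw [zero_add, dist_eq_norm, sub_zero, Complex.ofReal_one, div_one, mul_one, this]
  have hsin : 0 < Real.sin (Real.pi / 5) :=
    Real.sin_pos_of_pos_of_lt_pi (by positivity) (by linarith [Real.pi_pos])
  have him : ∀ x : ℝ, (Complex.exp (x * Complex.I)).im = Real.sin x := fun x =>
    Complex.exp_ofReal_mul_I_im x
  have htrue : (stdDart.half true).region ⊆ {z | 0 ≤ z.im} := by
    refine convexHull_min ?_ (convex_halfSpace_im_ge 0)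
    have := him (Real.pi / 5)
    push_cast at this
    rintro z (rfl | rfl | rfl) <;> simp [Tile.half, stdDart, Kind.axisLength, this]
    positivity
  have hfalse : (stdDart.half false).region ⊆ {z | z.im ≤ 0} := by
    refine convexHull_min ?_ (convex_halfSpace_im_le 0)
    have := him (-(Real.pi / 5))
    rw [Real.sin_neg] at this
    push_cast at this
    rintro z (rfl | rfl | rfl) <;> simp [Tile.half, stdDart, Kind.axisLength] at this ⊢
    rw [this]
    exact mul_nonpos_of_nonneg_of_nonpos hφ.le (neg_nonpos.2 hsin.le)
  have hnull : volume (LinearMap.ker Complex.imLm : Set ℂ) = 0 := by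
    refine Measure.addHaar_submodule _ _ fun h => ?_
    have : Complex.I ∈ LinearMap.ker Complex.imLm := h ▸ Submodule.mem_top
    simp at this
  have hdis : AEDisjoint volume (stdDart.half true).region (stdDart.half false).region := by
    refine measure_mono_null ?_ hnull
    rintro z ⟨hz₁, hz₂⟩
    exact le_antisymm (hfalse hz₂) (htrue hz₁)
  have hv : ∀ s, volume.real (stdDart.half s).region = halfDartArea := fun s => by
    rw [Measure.real, (hsc s).volume_region, ENNReal.toReal_ofReal]
    · simp [Tile.half, stdDart, Kind.axisLength]
    · have := halfDartArea_pos
      have := (stdDart.half s).kind.axisLength_pos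
      positivity
  rw [dartArea, Tile.region, measureReal_union₀
    (stdDart.half false).isCompact_region.measurableSet.nullMeasurableSet hdis
    (stdDart.half true).isCompact_region.measure_ne_top
    (stdDart.half false).isCompact_region.measure_ne_top, hv, hv, two_mul]

/-! ### Squares with a margin; a negative margin shrinks the square. -/

/-- The square `[x₁, x₁ + l] × [x₂, x₂ + l]` with a margin of width `d` added on each side. -/
def thickSquare (x₁ x₂ l d : ℝ) : Set ℂ :=
  Set.Icc (x₁ - d) (x₁ + l + d) ×ℂ Set.Icc (x₂ - d) (x₂ + l + d)

theorem square_eq_thickSquare (j₁ j₂ : ℕ) (l : ℝ) : square j₁ j₂ l = thickSquare j₁ j₂ l 0 := by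
  simp [square, thickSquare]

theorem volume_thickSquare {x₁ x₂ l d : ℝ} (h : 0 ≤ l + 2 * d) :
    volume (thickSquare x₁ x₂ l d) = ENNReal.ofReal ((l + 2 * d) ^ 2) := by
  have : thickSquare x₁ x₂ l d = Complex.measurableEquivRealProd ⁻¹'
      (Set.Icc (x₁ - d) (x₁ + l + d) ×ˢ Set.Icc (x₂ - d) (x₂ + l + d)) := rfl
  rw [this, Complex.volume_preserving_equiv_real_prod.measure_preimage_equiv,
    Measure.volume_eq_prod, Measure.prod_prod, Real.volume_Icc, Real.volume_Icc,
    ← ENNReal.ofReal_mul (by linarith)]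
  congr 1
  ring

theorem volume_real_thickSquare {x₁ x₂ l d : ℝ} (h : 0 ≤ l + 2 * d) :
    volume.real (thickSquare x₁ x₂ l d) = (l + 2 * d) ^ 2 := by
  rw [Measure.real, volume_thickSquare h, ENNReal.toReal_ofReal (by positivity)]

theorem mem_thickSquare_of_dist_le {x₁ x₂ l d e d' : ℝ} {x y : ℂ} (hx : x ∈ thickSquare x₁ x₂ l d)
    (hxy : dist x y ≤ e) (hd : d + e ≤ d') : y ∈ thickSquare x₁ x₂ l d' := by
  obtain ⟨⟨h₁, h₂⟩, h₃, h₄⟩ := hx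
  rw [Complex.dist_eq] at hxy
  have h₅ := abs_le.1 ((Complex.abs_re_le_norm _).trans hxy)
  have h₆ := abs_le.1 ((Complex.abs_im_le_norm _).trans hxy)
  rw [Complex.sub_re] at h₅
  rw [Complex.sub_im] at h₆
  exact ⟨⟨by linarith, by linarith⟩, by linarith, by linarith⟩

theorem thickSquare_mono {x₁ x₂ l d d' : ℝ} (hd : d ≤ d') :
    thickSquare x₁ x₂ l d ⊆ thickSquare x₁ x₂ l d' := fun x hx =>
  mem_thickSquare_of_dist_le (e := 0) hx (dist_self x).le (by linarith)

/-! ### Tiles, their halves, and finite patches. -/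

theorem Tile.ext_half {T T' : Tile} {s s' : Bool} (h : T.half s = T'.half s') : T = T' := by
  obtain ⟨k, a, b, hT⟩ := T
  obtain ⟨k', a', b', hT'⟩ := T'
  simp only [Tile.half, HalfTile.mk.injEq] at h
  obtain ⟨rfl, rfl, rfl, -⟩ := h
  rfl

theorem Tile.half_true_ne_half_false (T : Tile) : T.half true ≠ T.half false := by
  intro h
  have hk := T.kind.axisLength_pos
  have hφ := Real.goldenRatio_pos
  have hab : T.b - T.a ≠ 0 := by
    intro h0
    have := T.dist_eq
    rw [dist_comm, dist_eq_norm, h0, norm_zero] at this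
    exact hk.ne this
  simp only [Tile.half, HalfTile.mk.injEq, true_and, add_right_inj] at h
  have hu : (φ : ℂ) * ((T.b - T.a) / (T.kind.axisLength : ℂ)) ≠ 0 :=
    mul_ne_zero (by exact_mod_cast hφ.ne')
      (div_ne_zero hab (by exact_mod_cast hk.ne'))
  have hexp := congrArg Complex.im (mul_left_cancel₀ hu h)
  have e1 := Complex.exp_ofReal_mul_I_im (Real.pi / 5)
  have e2 := Complex.exp_ofReal_mul_I_im (-(Real.pi / 5))
  have hsin : 0 < Real.sin (Real.pi / 5) :=
    Real.sin_pos_of_pos_of_lt_pi (by positivity) (by linarith [Real.pi_pos])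
  rw [Real.sin_neg] at e2
  push_cast at e1 e2
  simp [-neg_mul, e1] at hexp
  rw [neg_one_mul] at hexp
  linarith

theorem Tile.half_region_subset (T : Tile) (s : Bool) : (T.half s).region ⊆ T.region := by
  cases s
  · exact Set.subset_union_right
  · exact Set.subset_union_left

theorem Tile.exists_mem_half {T : Tile} {x : ℂ} (hx : x ∈ T.region) :
    ∃ s, x ∈ (T.half s).region := by
  rcases hx with hx | hx
  · exact ⟨true, hx⟩
  · exact ⟨false, hx⟩

theorem Tile.a_mem_half (T : Tile) (s : Bool) : T.a ∈ (T.half s).region :=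
  subset_convexHull ℝ _ (by simp [Tile.half])

theorem IsPenroseTiling.hasScale_half {τ : Set Tile} (hτ : IsPenroseTiling τ) {T : Tile}
    (hT : T ∈ τ) (s : Bool) : (T.half s).HasScale 1 := by
  have hφ := Real.goldenRatio_pos
  obtain ⟨n, t, ht, h⟩ := hτ.patches {T} (by simpa using hT) (Set.finite_singleton T)
  have := (isDissection_deflateIter (by positivity) ht n).hasScale _ (h T rfl s)
  rwa [div_self (by positivity)] at this

/-- Both halves contain `a` and have diameter at most `φ`; the constant `4` is a round bound for `2
* φ`. -/
theorem IsPenroseTiling.dist_le {τ : Set Tile} (hτ : IsPenroseTiling τ) {T : Tile}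
    (hT : T ∈ τ) {x y : ℂ} (hx : x ∈ T.region) (hy : y ∈ T.region) : dist x y ≤ 4 := by
  obtain ⟨s, hs⟩ := Tile.exists_mem_half hx
  obtain ⟨s', hs'⟩ := Tile.exists_mem_half hy
  have h₁ := (hτ.hasScale_half hT s).dist_le one_pos hs (T.a_mem_half s)
  have h₂ := (hτ.hasScale_half hT s').dist_le one_pos (T.a_mem_half s') hs'
  have := Real.goldenRatio_lt_two
  linarith [dist_triangle x T.a y]

/-- The tiles have disjoint interiors of area at least `halfDartArea`, all inside one bounded
square. -/
theorem IsPenroseTiling.finite_meeting {τ : Set Tile} (hτ : IsPenroseTiling τ) {x₁ x₂ l : ℝ}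
    (hl : 0 ≤ l) : {T ∈ τ | (T.region ∩ thickSquare x₁ x₂ l 0).Nonempty}.Finite := by
  set P := {T ∈ τ | (T.region ∩ thickSquare x₁ x₂ l 0).Nonempty} with hP
  have hsub : ∀ T ∈ P, T.region ⊆ thickSquare x₁ x₂ l 4 := by
    rintro T ⟨hT, x, hxT, hx⟩ y hy
    exact mem_thickSquare_of_dist_le hx (hτ.dist_le hT hxT hy) (by norm_num)
  have hvol : ∀ T ∈ P, ENNReal.ofReal halfDartArea ≤ volume (interior T.region) := by
    intro T hT
    have h1 := hτ.hasScale_half hT.1 true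
    have hk : 1 ≤ (T.half true).kind.axisLength := by
      cases (T.half true).kind
      · exact Real.one_lt_goldenRatio.le
      · exact le_rfl
    have hα := halfDartArea_pos
    calc ENNReal.ofReal halfDartArea ≤ volume (T.half true).region := by
          rw [h1.volume_region]
          apply ENNReal.ofReal_le_ofReal
          nlinarith
      _ = volume (interior (T.half true).region) :=
          (measure_congr (interior_ae_eq_of_null_frontier
            ((convex_convexHull ℝ _).addHaar_frontier volume))).symm
      _ ≤ _ := measure_mono (interior_mono (T.half_region_subset true))
  have hfin := Measure.finite_const_le_meas_of_disjoint_iUnion (volume : Measure ℂ)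
    (ENNReal.ofReal_pos.2 halfDartArea_pos)
    (As := fun T : P => interior T.1.region) (fun T => isOpen_interior.measurableSet)
    (fun T T' h => hτ.disjoint T.2.1 T'.2.1 (fun h' => h (Subtype.ext h')))
    (ne_top_of_le_ne_top (b := volume (thickSquare x₁ x₂ l 4))
      (by rw [volume_thickSquare (by linarith)]; exact ENNReal.ofReal_ne_top)
      (measure_mono (Set.iUnion_subset fun T => interior_subset.trans (hsub T.1 T.2))))
  have huniv : {T : P | ENNReal.ofReal halfDartArea ≤ volume (interior T.1.region)} =
      Set.univ := Set.eq_univ_of_forall fun T => hvol T.1 T.2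
  rw [huniv] at hfin
  exact Set.finite_coe_iff.1 (Set.finite_univ_iff.1 hfin)

theorem ncard_halves {Q : Set Tile} (hQ : Q.Finite) :
    {h : HalfTile | ∃ T ∈ Q, ∃ s, h = T.half s}.Finite ∧
      {h : HalfTile | ∃ T ∈ Q, ∃ s, h = T.half s}.ncard = 2 * Q.ncard := by
  have heq : {h : HalfTile | ∃ T ∈ Q, ∃ s, h = T.half s} =
      (fun T : Tile => T.half true) '' Q ∪ (fun T : Tile => T.half false) '' Q := by
    ext h
    constructor
    · rintro ⟨T, hT, s, rfl⟩
      cases s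
      · exact Or.inr ⟨T, hT, rfl⟩
      · exact Or.inl ⟨T, hT, rfl⟩
    · rintro (⟨T, hT, rfl⟩ | ⟨T, hT, rfl⟩)
      · exact ⟨T, hT, true, rfl⟩
      · exact ⟨T, hT, false, rfl⟩
  have hdis : Disjoint ((fun T : Tile => T.half true) '' Q)
      ((fun T : Tile => T.half false) '' Q) := by
    rw [Set.disjoint_left]
    rintro _ ⟨T, hT, rfl⟩ ⟨T', hT', h⟩
    simp only at h
    obtain rfl := Tile.ext_half h
    exact T'.half_true_ne_half_false h.symm
  rw [heq]
  refine ⟨(hQ.image _).union (hQ.image _), ?_⟩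
  rw [Set.ncard_union_eq hdis (hQ.image _) (hQ.image _),
    Set.ncard_image_of_injective Q fun T T' h => Tile.ext_half h,
    Set.ncard_image_of_injective Q fun T T' h => Tile.ext_half h, two_mul]

/-! ### Marked points in a square. -/

/-- The number of tiles whose marked point lies in a square of side `l`, up to errors from supertiles of
order `m` at the boundary of the square and from the second eigenvalue of deflation. -/
theorem IsPenroseTiling.ncard_bounds {τ : Set Tile} (hτ : IsPenroseTiling τ) {y : Tile → ℂ}
    (hy : ∀ T ∈ τ, y T ∈ T.region) {x₁ x₂ l : ℝ} {m : ℕ} (hl : 2 * (4 + φ * φ ^ m) ≤ l) :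
    {T ∈ τ | y T ∈ thickSquare x₁ x₂ l 0}.Finite ∧
    (1 - φ⁻¹ ^ (4 * m)) * (halfTileDensity * (l - 2 * (4 + φ * φ ^ m)) ^ 2) ≤
      2 * ({T ∈ τ | y T ∈ thickSquare x₁ x₂ l 0}.ncard : ℝ) ∧
    2 * ({T ∈ τ | y T ∈ thickSquare x₁ x₂ l 0}.ncard : ℝ) ≤
      (1 + φ⁻¹ ^ (4 * m)) * (halfTileDensity * (l + 2 * (4 + φ * φ ^ m)) ^ 2) := by
  have hφ := Real.goldenRatio_pos
  have hφ1 := Real.one_lt_goldenRatio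
  have hm : 0 < φ ^ m := by positivity
  have hκ := halfTileDensity_pos
  have hl0 : 0 ≤ l := le_trans (by positivity) hl
  have hε1 : φ⁻¹ ^ (4 * m) ≤ 1 := pow_le_one₀ inv_goldenRatio_pos.le inv_goldenRatio_lt_one.le
  have hε0 : 0 ≤ φ⁻¹ ^ (4 * m) := pow_nonneg inv_goldenRatio_pos.le _
  set P := {T ∈ τ | (T.region ∩ thickSquare x₁ x₂ l 0).Nonempty} with hP
  set Q := {T ∈ τ | y T ∈ thickSquare x₁ x₂ l 0} with hQ
  have hPfin : P.Finite := hτ.finite_meeting hl0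
  have hQP : Q ⊆ P := fun T hT => ⟨hT.1, y T, hy T hT.1, hT.2⟩
  have hQfin : Q.Finite := hPfin.subset hQP
  obtain ⟨n, t, ht, hpatch⟩ := hτ.patches P (fun T hT => hT.1) hPfin
  have hn : 0 < φ ^ n := by positivity
  have D := isDissection_deflateIter hn ht n
  rw [div_self hn.ne'] at D
  have hcover : ∀ x ∈ thickSquare x₁ x₂ l 0, ∃ T ∈ P, x ∈ T.region := by
    intro x hx
    have hx' : x ∈ ⋃ T ∈ τ, T.region := hτ.covers ▸ Set.mem_univ x
    obtain ⟨T, hT, hxT⟩ := Set.mem_iUnion₂.1 hx'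
    exact ⟨T, ⟨hT, x, hxT, hx⟩, hxT⟩
  have hsubt : thickSquare x₁ x₂ l 0 ⊆ t.region := by
    intro x hx
    obtain ⟨T, hT, hxT⟩ := hcover x hx
    obtain ⟨s, hs⟩ := Tile.exists_mem_half hxT
    exact D.subset (hpatch T hT s) hs
  -- The half tile `t` contains a side of the square, so `l ≤ φ ^ (n + 1)`; for `n < m` this is at
  -- most `φ ^ m < l`.
  have hmn : m ≤ n := by
    by_contra! hlt
    have h₁ : (⟨x₁, x₂⟩ : ℂ) ∈ thickSquare x₁ x₂ l 0 :=
      ⟨⟨by simp, by simpa using hl0⟩, by simp, by simpa using hl0⟩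
    have h₂ : (⟨x₁ + l, x₂⟩ : ℂ) ∈ thickSquare x₁ x₂ l 0 :=
      ⟨⟨by simpa using hl0, by simp⟩, by simp, by simpa using hl0⟩
    have h₃ := ht.dist_le hn (hsubt h₁) (hsubt h₂)
    rw [Complex.dist_of_im_eq (z := ⟨x₁, x₂⟩) (w := ⟨x₁ + l, x₂⟩) rfl, Real.dist_eq, sub_add_cancel_left, abs_neg, abs_of_nonneg hl0,
      ← pow_succ'] at h₃
    have h₄ : φ ^ (n + 1) ≤ φ ^ m := pow_le_pow_right₀ hφ1.le hlt
    nlinarith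
  have DS := isDissection_deflateIter hn ht (n - m)
  have hscale : φ ^ n / φ ^ (n - m) = φ ^ m := by
    rw [div_eq_iff (by positivity), ← pow_add, Nat.add_sub_cancel' hmn]
  rw [hscale] at DS
  have hiter : t.deflateIter n = ⋃ s ∈ t.deflateIter (n - m), s.deflateIter m := by
    rw [← HalfTile.deflateIter_add, Nat.sub_add_cancel hmn]
  set S := t.deflateIter (n - m) with hS
  have hsub : ∀ s ∈ S, ∀ h ∈ s.deflateIter m, h.region ⊆ s.region := fun s hs h hh =>
    (isDissection_deflateIter hm (DS.hasScale s hs) m).subset hh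
  obtain ⟨hHfin, hHcard⟩ := ncard_halves hQfin
  set H := {h : HalfTile | ∃ T ∈ Q, ∃ s, h = T.half s} with hH
  have hHcard' : 2 * (Q.ncard : ℝ) = H.ncard := by rw [hHcard]; push_cast; rfl
  have hSfin : ∀ S' ⊆ S, (⋃ s ∈ S', s.deflateIter m).Finite := fun S' hS' =>
    (DS.finite.subset hS').biUnion fun s hs =>
      (isDissection_deflateIter hm (DS.hasScale s (hS' hs)) m).finite
  refine ⟨hQfin, ?_, ?_⟩
  -- The margin `-4` pays for the diameter of a tile: a tile with its vertex `a` in the shrunk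
  -- square has its marked point in the square.
  · set Sin := {s ∈ S | s.region ⊆ thickSquare x₁ x₂ l (-4)} with hSin
    have hSinS : Sin ⊆ S := fun s hs => hs.1
    have hG : (⋃ s ∈ Sin, s.deflateIter m) ⊆ H := by
      intro h hh
      obtain ⟨s, hs, hh⟩ := Set.mem_iUnion₂.1 hh
      have hhn : h ∈ t.deflateIter n := hiter ▸ Set.mem_iUnion₂.2 ⟨s, hs.1, hh⟩
      have hreg := (hsub s hs.1 h hh).trans hs.2
      -- A half tile of the big patch need not come from `τ`. But `P` covers the square, so `h`
      -- overlaps some half of a tile of `P` in positive area; both belong to the dissection `D`, so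
      -- they coincide.
      have hmeet : ∃ T ∈ P, ∃ b, ¬ AEDisjoint volume h.region (T.half b).region := by
        by_contra! hcon
        have hnull : volume (⋃ T ∈ P, (h.region ∩ (T.half true).region ∪
            h.region ∩ (T.half false).region)) = 0 :=
          (measure_biUnion_null_iff hPfin.countable).2 fun T hT =>
            measure_union_null (hcon T hT true) (hcon T hT false)
        have hcov : h.region ⊆ ⋃ T ∈ P, (h.region ∩ (T.half true).region ∪
            h.region ∩ (T.half false).region) := by
          intro x hx
          obtain ⟨T, hT, hxT⟩ := hcover x (thickSquare_mono (by norm_num) (hreg hx))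
          exact Set.mem_iUnion₂.2 ⟨T, hT, hxT.imp (fun h' => ⟨hx, h'⟩) fun h' => ⟨hx, h'⟩⟩
        exact ((D.hasScale h hhn).volume_region_pos one_pos).ne' (measure_mono_null hcov hnull)
      obtain ⟨T, hT, b, hTb⟩ := hmeet
      have hhT : h = T.half b := by
        by_contra hne
        exact hTb (D.aedisjoint hhn (hpatch T hT b) hne)
      have ha : T.a ∈ thickSquare x₁ x₂ l (-4) := hreg (hhT ▸ T.a_mem_half b)
      exact ⟨T, ⟨hT.1, mem_thickSquare_of_dist_le ha
        (hτ.dist_le hT.1 (T.half_region_subset b (T.a_mem_half b)) (hy T hT.1))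
        (by norm_num)⟩, b, hhT⟩
    have Din := DS.mono hSinS
    have hcard : ((⋃ s ∈ Sin, s.deflateIter m).ncard : ℝ) ≤ H.ncard := by
      exact_mod_cast Set.ncard_le_ncard hG hHfin
    have harea : (l - 2 * (4 + φ * φ ^ m)) ^ 2 ≤ volume.real (⋃ s ∈ Sin, s.region) := by
      have hle : thickSquare x₁ x₂ l (-(4 + φ * φ ^ m)) ⊆ ⋃ s ∈ Sin, s.region := by
        intro x hx
        have hpos : 0 < φ * φ ^ m := by positivity
        obtain ⟨s, hs, hxs⟩ := DS.exists_mem (hsubt (thickSquare_mono (by linarith) hx))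
        refine Set.mem_iUnion₂.2 ⟨s, ⟨hs, fun z hz => ?_⟩, hxs⟩
        exact mem_thickSquare_of_dist_le hx ((DS.hasScale s hs).dist_le hm hxs hz) (by linarith)
      have hfin : volume (⋃ s ∈ Sin, s.region) ≠ ⊤ :=
        (Din.finite.isCompact_biUnion fun s _ => s.isCompact_region).measure_ne_top
      have := measureReal_mono hle hfin
      rw [volume_real_thickSquare (by linarith)] at this
      linarith
    have habs := (abs_le.1 Din.abs_ncard_sub_le).1
    rw [hHcard']
    calc _ ≤ (1 - φ⁻¹ ^ (4 * m)) * (halfTileDensity * volume.real (⋃ s ∈ Sin, s.region)) := by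
          refine mul_le_mul_of_nonneg_left ?_ (sub_nonneg.2 hε1)
          exact mul_le_mul_of_nonneg_left harea hκ.le
      _ ≤ _ := by linarith
  -- Conversely, a tile with its marked point in the square has its vertex `a` within margin `4`, so
  -- its halves lie in supertiles that meet the enlarged square.
  · set Sout := {s ∈ S | (s.region ∩ thickSquare x₁ x₂ l 4).Nonempty} with hSout
    have hSoutS : Sout ⊆ S := fun s hs => hs.1
    have hG : H ⊆ ⋃ s ∈ Sout, s.deflateIter m := by
      rintro h ⟨T, hT, b, rfl⟩
      have hhn := hpatch T (hQP hT) b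
      rw [hiter] at hhn
      obtain ⟨s, hs, hh⟩ := Set.mem_iUnion₂.1 hhn
      refine Set.mem_iUnion₂.2 ⟨s, ⟨hs, T.a, hsub s hs _ hh (T.a_mem_half b), ?_⟩, hh⟩
      exact mem_thickSquare_of_dist_le hT.2
        (hτ.dist_le hT.1 (hy T hT.1) (T.half_region_subset b (T.a_mem_half b))) (by norm_num)
    have Dout := DS.mono hSoutS
    have hcard : (H.ncard : ℝ) ≤ (⋃ s ∈ Sout, s.deflateIter m).ncard := by
      exact_mod_cast Set.ncard_le_ncard hG (hSfin Sout hSoutS)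
    have harea : volume.real (⋃ s ∈ Sout, s.region) ≤ (l + 2 * (4 + φ * φ ^ m)) ^ 2 := by
      have hle : ⋃ s ∈ Sout, s.region ⊆ thickSquare x₁ x₂ l (4 + φ * φ ^ m) := by
        refine Set.iUnion₂_subset fun s hs z hz => ?_
        obtain ⟨hs, x, hxs, hx⟩ := hs
        exact mem_thickSquare_of_dist_le hx ((DS.hasScale s hs).dist_le hm hxs hz) le_rfl
      have hnn : 0 ≤ l + 2 * (4 + φ * φ ^ m) := by positivity
      rw [← volume_real_thickSquare (x₁ := x₁) (x₂ := x₂) hnn]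
      refine measureReal_mono hle ?_
      rw [volume_thickSquare hnn]
      exact ENNReal.ofReal_ne_top
    have habs := (abs_le.1 Dout.abs_ncard_sub_le).2
    rw [hHcard']
    calc _ ≤ (1 + φ⁻¹ ^ (4 * m)) * (halfTileDensity * volume.real (⋃ s ∈ Sout, s.region)) := by
          linarith
      _ ≤ _ := by
          refine mul_le_mul_of_nonneg_left ?_ (by positivity)
          exact mul_le_mul_of_nonneg_left harea hκ.le

/-! ### Numerical estimates and conclusion. -/

theorem e_le_of_bounds {Y U : Set ℂ} {ρ A δ : ℝ} (hρ : 0 < ρ) (hδ : 0 ≤ δ)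
    (hU : volume U = ENNReal.ofReal A) {N : ℕ} (hN : (U ∩ Y).encard = N)
    (h₁ : ρ * A ≤ (1 + δ) * N) (h₂ : N ≤ (1 + δ) * (ρ * A)) :
    e Y ρ U ≤ 1 + ENNReal.ofReal δ := by
  have hW : ENNReal.ofReal ρ * volume U = ENNReal.ofReal (ρ * A) := by
    rw [hU, ENNReal.ofReal_mul hρ.le]
  have hN' : ((N : ℕ∞) : ENNReal) = ENNReal.ofReal N := by simp
  have h1 : 1 + ENNReal.ofReal δ = ENNReal.ofReal (1 + δ) := by
    rw [ENNReal.ofReal_add zero_le_one hδ, ENNReal.ofReal_one]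
  rw [e, hW, hN, hN', h1]
  refine max_le (ENNReal.div_le_of_le_mul ?_) (ENNReal.div_le_of_le_mul ?_) <;>
    rw [← ENNReal.ofReal_mul (by positivity)] <;> exact ENNReal.ofReal_le_ofReal ‹_›

/-- Here `i ≥ 50` gives `i / 3 ≥ 16` and `φ ^ 16 ≥ 2 ^ 8 = 256`; this large factor absorbs the
constants in the collar estimate. -/
theorem goldenRatio_pow_bounds {i : ℕ} (hi : 50 ≤ i) :
    0 < φ⁻¹ ^ (i / 3) ∧ φ⁻¹ ^ (i / 3) ≤ 1 / 256 ∧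
      2 * (4 + φ * φ ^ (i / 3)) ≤ φ⁻¹ ^ (i / 3) / 20 * 2 ^ i ∧
      5 * φ⁻¹ ^ (i / 3) ≤ 10 * φ ^ (-((i : ℝ) / 3)) := by
  have hφ := Real.goldenRatio_pos
  have hφ1 := Real.one_lt_goldenRatio
  have hφ2 := Real.goldenRatio_lt_two
  have hsq := Real.goldenRatio_sq
  obtain ⟨m, hm⟩ : ∃ m, m = i / 3 := ⟨_, rfl⟩
  have hm16 : 16 ≤ m := by omega
  have h3m : 3 * m ≤ i := by omega
  have him : (i : ℝ) ≤ 3 * m + 3 := by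
    have : i ≤ 3 * m + 3 := by omega
    exact_mod_cast this
  rw [← hm]
  have hz : 0 < φ⁻¹ ^ m := pow_pos inv_goldenRatio_pos m
  have hx1 : (1 : ℝ) ≤ φ ^ m := one_le_pow₀ hφ1.le
  have hxz : φ⁻¹ ^ m * φ ^ m = 1 := by rw [← mul_pow, inv_mul_cancel₀ hφ.ne', one_pow]
  have hx256 : (256 : ℝ) ≤ φ ^ m := by
    calc (256 : ℝ) = 2 ^ 8 := by norm_num
      _ ≤ (φ ^ 2) ^ 8 := pow_le_pow_left₀ (by norm_num) (by linarith) 8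
      _ = φ ^ 16 := by rw [← pow_mul]
      _ ≤ φ ^ m := pow_le_pow_right₀ hφ1.le hm16
  have hL : φ ^ m * φ ^ m * φ ^ m ≤ 2 ^ i := by
    calc φ ^ m * φ ^ m * φ ^ m = φ ^ (3 * m) := by rw [← pow_add, ← pow_add]; congr 1; ring
      _ ≤ φ ^ i := pow_le_pow_right₀ hφ1.le h3m
      _ ≤ 2 ^ i := pow_le_pow_left₀ hφ.le hφ2.le i
  refine ⟨hz, ?_, ?_, ?_⟩
  · rw [le_div_iff₀ (by norm_num), ← hxz]
    exact mul_le_mul_of_nonneg_left hx256 hz.le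
  · have h4 : φ ^ m * φ ^ m ≤ φ⁻¹ ^ m * 2 ^ i := by
      calc φ ^ m * φ ^ m = φ⁻¹ ^ m * φ ^ m * (φ ^ m * φ ^ m) := by rw [hxz, one_mul]
        _ = φ⁻¹ ^ m * (φ ^ m * φ ^ m * φ ^ m) := by ring
        _ ≤ _ := mul_le_mul_of_nonneg_left hL hz.le
    have h5 : 256 * φ ^ m ≤ φ ^ m * φ ^ m := mul_le_mul_of_nonneg_right hx256 (by positivity)
    have h6 : φ * φ ^ m ≤ 2 * φ ^ m := mul_le_mul_of_nonneg_right hφ2.le (by positivity)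
    have h7 : φ⁻¹ ^ m / 20 * 2 ^ i = φ⁻¹ ^ m * 2 ^ i / 20 := by ring
    rw [h7]
    linarith
  -- Rounding `i / 3` down costs at most one factor `φ < 2`, which turns `5` into `10`.
  · have h7 : φ⁻¹ ^ m * φ⁻¹ ≤ φ ^ (-((i : ℝ) / 3)) := by
      rw [← pow_succ, inv_pow, ← Real.rpow_natCast, ← Real.rpow_neg hφ.le]
      refine Real.rpow_le_rpow_of_exponent_le hφ1.le ?_
      push_cast
      linarith
    have h8 : 1 / 2 ≤ φ⁻¹ := by
      rw [one_div]
      exact inv_anti₀ hφ hφ2.le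
    have h9 : φ⁻¹ ^ m * (1 / 2) ≤ φ⁻¹ ^ m * φ⁻¹ := mul_le_mul_of_nonneg_left h8 hz.le
    linarith

end KiteDart

open KiteDart MeasureTheory in
theorem proposition2p3 (τ : Set KiteDart.Tile) (hτ : KiteDart.IsPenroseTiling τ)
    (Y : Set ℂ) (hY : KiteDart.IsCreatedBy Y τ)
    (ρ : ℝ) (hρ : ρ = Real.goldenRatio ^ 2 / ((1 + Real.goldenRatio ^ 2) * KiteDart.dartArea))
    (i : ℕ) (hi : 50 ≤ i) :
    KiteDart.E Y ρ (2 ^ i) - 1 ≤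
      ENNReal.ofReal (10 * Real.goldenRatio ^ (-((i : ℝ) / 3))) := by
  obtain ⟨-, y, hy, hinj, rfl⟩ := hY
  obtain ⟨hz0, hz1, hR, hδ⟩ := goldenRatio_pow_bounds hi
  have hφ := Real.goldenRatio_pos
  -- Each tile has two halves, so the density of half tiles is twice that of marked points.
  have hκ : halfTileDensity = 2 * ρ := by
    have := halfDartArea_pos
    rw [hρ, dartArea_eq, halfTileDensity]
    field_simp
  have hρ0 : 0 < ρ := by linarith [halfTileDensity_pos]
  have hL : (0 : ℝ) < 2 ^ i := by positivity
  rw [tsub_le_iff_left, E]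
  refine iSup₂_le fun j₁ j₂ => ?_
  rw [square_eq_thickSquare]
  have hl : 2 * (4 + φ * φ ^ (i / 3)) ≤ 2 ^ i := hR.trans (by nlinarith)
  obtain ⟨hfin, hlow, hupp⟩ := hτ.ncard_bounds hy (x₁ := j₁) (x₂ := j₂) hl
  set Q := {T ∈ τ | y T ∈ thickSquare j₁ j₂ (2 ^ i) 0} with hQ
  have hcard : (thickSquare j₁ j₂ (2 ^ i) 0 ∩ y '' τ).encard = Q.ncard := by
    have : thickSquare j₁ j₂ (2 ^ i) 0 ∩ y '' τ = y '' Q := by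
      ext x
      constructor
      · rintro ⟨hx, T, hT, rfl⟩
        exact ⟨T, ⟨hT, hx⟩, rfl⟩
      · rintro ⟨T, hT, rfl⟩
        exact ⟨hT.2, T, hT.1, rfl⟩
    rw [this, (hinj.mono fun T hT => hT.1).encard_image, hfin.cast_ncard_eq]
  have hvol : volume (thickSquare j₁ j₂ (2 ^ i) 0) = ENNReal.ofReal ((2 ^ i) ^ 2) := by
    rw [volume_thickSquare (by linarith), mul_zero, add_zero]
  rw [hκ, mul_comm 4, pow_mul] at hlow hupp
  have hR0 : 0 ≤ 2 * (4 + φ * φ ^ (i / 3)) := by positivity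
  generalize (10 * φ ^ (-((i : ℝ) / 3))) = δ at *
  generalize φ⁻¹ ^ (i / 3) = z at *
  generalize 2 * (4 + φ * φ ^ (i / 3)) = R at *
  generalize ((2 : ℝ) ^ i) = L at *
  have hz4 : z ^ 4 ≤ z / 20 := by
    have : z ^ 3 ≤ 1 / 20 := (pow_le_pow_left₀ hz0.le hz1 3).trans (by norm_num)
    nlinarith
  have hN0 : (0 : ℝ) ≤ Q.ncard := Nat.cast_nonneg _
  generalize (Q.ncard) = N at *
  have hW : 0 < ρ * L ^ 2 := by positivity
  -- With this unit the collar satisfies `R ≤ v * L`, the eigenvalue error is `z ^ 4 ≤ v`, and `100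
  -- * v ≤ δ`. Two factors from the area and one from the count give `(1 - v) ^ 3` and `(1 + v) ^
  -- 3`, well within `δ`.
  obtain ⟨v, rfl⟩ : ∃ v, z = 20 * v := ⟨z / 20, by ring⟩
  rw [mul_div_cancel_left₀ v (by norm_num : (20 : ℝ) ≠ 0)] at hR hz4
  have hv0 : 0 < v := by linarith
  have hv1 : v ≤ 1 / 100 := by linarith
  refine e_le_of_bounds hρ0 (by linarith) hvol hcard ?_ ?_
  · have h₁ : (1 - v) * L ≤ L - R := by linarith
    have h₂ : ((1 - v) * L) ^ 2 ≤ (L - R) ^ 2 :=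
      pow_le_pow_left₀ (mul_nonneg (by linarith) hL.le) h₁ 2
    have h₃ : (1 - v) * (ρ * ((1 - v) * L) ^ 2) ≤ (1 - (20 * v) ^ 4) * (ρ * (L - R) ^ 2) := by
      refine mul_le_mul (by linarith) (mul_le_mul_of_nonneg_left h₂ hρ0.le) (by positivity)
        (by linarith)
    have h₄ : (1 - v) ^ 3 * (ρ * L ^ 2) ≤ N := by linarith
    have h₅ : 1 ≤ (1 + δ) * (1 - v) ^ 3 := by
      have h6 : 1 - 3 * v ≤ (1 - v) ^ 3 := by nlinarith [mul_pos hv0 hv0]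
      calc (1 : ℝ) ≤ (1 + 100 * v) * (1 - 3 * v) := by nlinarith
        _ ≤ (1 + δ) * (1 - v) ^ 3 :=
          mul_le_mul (by linarith) h6 (by linarith) (by linarith)
    calc ρ * L ^ 2 ≤ (1 + δ) * (1 - v) ^ 3 * (ρ * L ^ 2) := le_mul_of_one_le_left hW.le h₅
      _ = (1 + δ) * ((1 - v) ^ 3 * (ρ * L ^ 2)) := by ring
      _ ≤ _ := mul_le_mul_of_nonneg_left h₄ (by linarith)
  · have h₁ : (L + R) ^ 2 ≤ ((1 + v) * L) ^ 2 :=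
      pow_le_pow_left₀ (by linarith) (by linarith) 2
    have h₂ : (1 + (20 * v) ^ 4) * (ρ * (L + R) ^ 2) ≤ (1 + v) * (ρ * ((1 + v) * L) ^ 2) :=
      mul_le_mul (by linarith) (mul_le_mul_of_nonneg_left h₁ hρ0.le) (by positivity) (by linarith)
    have h₃ : (1 + v) ^ 3 ≤ 1 + δ := by nlinarith [mul_pos hv0 hv0]
    calc (N : ℝ) ≤ (1 + v) ^ 3 * (ρ * L ^ 2) := by linarith
      _ ≤ _ := mul_le_mul_of_nonneg_right h₃ hW.le
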